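/- Let $k$ be a field, $n\ge 2$, $\otimes=\otimes_k$, $B=k[x]/(x^n)$, and let $\bar x$ be the class of $x$. Let $A$ be an associative unital $k$-algebra, $\sigma$ a $k$-algebra automorphism of $A$ and $\delta:A\to A$ a left $\sigma$-derivation, i.e. a $k$-linear map with $\delta(aa')=\delta(a)a'+\sigma(a)\delta(a')$. For a $k$-vector space $V$ and $k$-linear maps $s,t:V\to V$ let $T_{s,t}:B\otimes V\to V\otimes B$ be the $k$-linear map obtained from $T_{s,t}(1\otimes v)=v\otimes 1$ and $T_{s,t}(\bar x\otimes v)=s(v)\otimes\bar x+t(v)\otimes 1$ by iteration, that is, by $T_{s,t}(\bar x^{\,l+1}\otimes v)=(1\otimes m_B)(T_{s,t}\otimes 1)(1\otimes T_{s,t})(\bar x\otimes\bar x^{\,l}\otimes v)$ for $l+1<n$. Put $\tau=T_{\sigma,\delta}$, and assume that $\tau$ is a twisting map: it is bijective, $\tau(1\otimes a)=a\otimes 1$, $\tau(b\otimes 1)=1\otimes b$, and $\tau(m_B\otimes m_A)=(m_A\otimes m_B)(1\otimes\tau\otimes 1)(\tau\otimes\tau)(1\otimes\tau\otimes 1)$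 on $B\otimes B\otimes A\otimes A$. The truncated Ore extension $A[\bar x;\sigma,\delta]=A\otimes_\tau B$ is the vector space $A\otimes B$ with multiplication $(m_A\otimes m_B)(1\otimes\tau\otimes 1)$. A left $A$-module $L$, with structure map $\rho_L$, is called compatible with $\tau$ via a $k$-linear map $T:B\otimes L\to L\otimes B$ if $T$ is bijective, $T(m_B\otimes 1)=(1\otimes m_B)(T\otimes 1)(1\otimes T)$ and $T(1\otimes\rho_L)=(\rho_L\otimes 1)(1\otimes T)(\tau\otimes 1)$. In that case $L\otimes N$, for any left $B$-module $N$, is a left $A\otimes_\tau B$-module via $(\rho_L\otimes\rho_N)(1\otimes T\otimes 1)$. Let $M$ be a left $A[\bar x;\sigma,\delta]$-module, regarded also as an $A$-module, and let $f:M\to M$ be the action of $\bar x$. Let $\phi:M\to M$ be a bijective $k$-linear map with $\phi(am)=\sigma(a)\phi(m)$ (an isomorphism $M\cong M^\sigma$ of $A$-modules), and assume that $M$ is compatible with $\tau$ via $\tau_{B,M}=T_{\phi,f}$. Let $\cdots\to P_1\to P_0\xrightarrow{\mu}M\to 0$ be a resolution of $M$ by free left $A$-modules, with differentials $d'$. Let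 $\sigma_i:P_i\to P_i$ $(i\ge 0)$ be $k$-linear maps that commute with $d'$ and satisfy $\sigma_i(az)=\sigma(a)\sigma_i(z)$ and $\phi^{-1}\mu\sigma_0=\mu$. Let $\delta_i:P_i\to P_i$ $(i\ge 0)$ be $k$-linear maps that commute with $d'$ and satisfy $\delta_i(az)=\sigma(a)\delta_i(z)+\delta(a)z$ and $\mu\delta_0=f\mu$. Assume that the resolution $P_\bullet$ is compatible with $\tau$ via $\tau_{B,i}=T_{\sigma_i,\delta_i}$, i.e. each $P_i$ is compatible with $\tau$ via $\tau_{B,i}$ and the $\tau_{B,i}$ form a chain map $B\otimes P_\bullet\to P_\bullet\otimes B$ lifting $\tau_{B,M}$. Suppose finally that every $\sigma_i$ is bijective. Let $Q_\bullet$ be the standard resolution $\cdots\xrightarrow{\bar x}B\xrightarrow{\bar x^{\,n-1}}B\xrightarrow{\bar x}B\xrightarrow{\varepsilon}k\to 0$ of $k$ over $B$, where $\varepsilon(\bar x)=0$, with differentials $d''$. Then the twisted product complex $$X_m=\bigoplus_{i+j=m}P_i\otimes Q_j,\qquad d=d'\otimes 1+(-1)^i\,1\otimes d''\ \text{ on }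 P_i\otimes Q_j,$$ where each $P_i\otimes Q_j$ carries the above left $A\otimes_\tau B$-module structure, augmented by $\mu\otimes\varepsilon:X_0\to M\otimes k= M$, is a projective resolution of $M$ over $A[\bar x;\sigma,\delta]$: the maps are $A[\bar x;\sigma,\delta]$-linear, every $X_m$ is a projective $A[\bar x;\sigma,\delta]$-module, and $\cdots\to X_1\to X_0\to M\to 0$ is exact. -/

import Mathlib

open scoped TensorProduct Polynomial

namespace TruncOre

noncomputable section

/-! ### Twisting maps and twisted tensor product algebras -/

section Middle

variable {k W X Y Y' X' Z : Type*} [CommRing k]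
  [AddCommGroup W] [Module k W] [AddCommGroup X] [Module k X] [AddCommGroup Y] [Module k Y]
  [AddCommGroup Y'] [Module k Y'] [AddCommGroup X'] [Module k X'] [AddCommGroup Z] [Module k Z]

/-- The map `1 ⊗ f ⊗ 1 : W ⊗ X ⊗ Y ⊗ Z → W ⊗ Y' ⊗ X' ⊗ Z` for `f : X ⊗ Y → Y' ⊗ X'`. -/
def mid (f : X ⊗[k] Y →ₗ[k] Y' ⊗[k] X') :
    (W ⊗[k] X) ⊗[k] (Y ⊗[k] Z) →ₗ[k] (W ⊗[k] Y') ⊗[k] (X' ⊗[k] Z) :=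
  (TensorProduct.assoc k W Y' (X' ⊗[k] Z)).symm.toLinearMap
    ∘ₗ LinearMap.lTensor W ((TensorProduct.assoc k Y' X' Z).toLinearMap
        ∘ₗ LinearMap.rTensor Z f ∘ₗ (TensorProduct.assoc k X Y Z).symm.toLinearMap)
    ∘ₗ (TensorProduct.assoc k W X (Y ⊗[k] Z)).toLinearMap

end Middle

section Action

variable (k R V : Type*) [CommRing k] [Ring R] [Algebra k R] [AddCommGroup V] [Module k V]
  [Module R V] [IsScalarTower k R V]

/-- The structure map `ρ : R ⊗ V → V`, `r ⊗ v ↦ r • v`, of a left module over a `k`-algebra. -/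
def act : R ⊗[k] V →ₗ[k] V := TensorProduct.lift (Algebra.lsmul k k V).toLinearMap

end Action

section Twisting

variable {k A B : Type*} [CommRing k] [Ring A] [Algebra k A] [Ring B] [Algebra k B]

/-- `τ : B ⊗ A → A ⊗ B` is a twisting map. -/
structure IsTwistingMap (τ : B ⊗[k] A →ₗ[k] A ⊗[k] B) : Prop where
  bijective : Function.Bijective τ
  one_tmul : ∀ a : A, τ (1 ⊗ₜ a) = a ⊗ₜ 1
  tmul_one : ∀ b : B, τ (b ⊗ₜ 1) = 1 ⊗ₜ b
  mul : τ ∘ₗ TensorProduct.map (LinearMap.mul' k B) (LinearMap.mul' k A) =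
    TensorProduct.map (LinearMap.mul' k A) (LinearMap.mul' k B) ∘ₗ mid τ
      ∘ₗ TensorProduct.map τ τ ∘ₗ mid τ

/-- A left `A`-module `M` is compatible with `τ` via `T : B ⊗ M → M ⊗ B`. -/
structure IsCompatible (τ : B ⊗[k] A →ₗ[k] A ⊗[k] B) {M : Type*} [AddCommGroup M] [Module k M]
    [Module A M] [IsScalarTower k A M] (T : B ⊗[k] M →ₗ[k] M ⊗[k] B) : Prop where
  bijective : Function.Bijective T
  mul : T ∘ₗ LinearMap.rTensor M (LinearMap.mul' k B) =
    LinearMap.lTensor M (LinearMap.mul' k B)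
      ∘ₗ (TensorProduct.assoc k M B B).toLinearMap
      ∘ₗ LinearMap.rTensor B T
      ∘ₗ (TensorProduct.assoc k B M B).symm.toLinearMap
      ∘ₗ LinearMap.lTensor B T
      ∘ₗ (TensorProduct.assoc k B B M).toLinearMap
  act : T ∘ₗ LinearMap.lTensor B (act k A M) =
    LinearMap.rTensor B (act k A M)
      ∘ₗ (TensorProduct.assoc k A M B).symm.toLinearMap
      ∘ₗ LinearMap.lTensor A T
      ∘ₗ (TensorProduct.assoc k A B M).toLinearMap
      ∘ₗ LinearMap.rTensor M τ
      ∘ₗ (TensorProduct.assoc k B A M).symm.toLinearMap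

variable {M N : Type*} [AddCommGroup M] [Module k M] [Module A M] [IsScalarTower k A M]
  [AddCommGroup N] [Module k N] [Module B N] [IsScalarTower k B N]

variable (A N) in
/-- The action map `(A ⊗ B) ⊗ (M ⊗ N) → M ⊗ N`, namely `(ρ_A ⊗ ρ_B) ∘ (1 ⊗ T ⊗ 1)`. -/
def twistedAct (T : B ⊗[k] M →ₗ[k] M ⊗[k] B) :
    (A ⊗[k] B) ⊗[k] (M ⊗[k] N) →ₗ[k] M ⊗[k] N :=
  TensorProduct.map (act k A M) (act k B N) ∘ₗ mid T

/-- The multiplication `(m_A ⊗ m_B) ∘ (1 ⊗ τ ⊗ 1)` on `A ⊗ B`. -/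
def twistedMul (τ : B ⊗[k] A →ₗ[k] A ⊗[k] B) :
    (A ⊗[k] B) ⊗[k] (A ⊗[k] B) →ₗ[k] A ⊗[k] B :=
  TensorProduct.map (LinearMap.mul' k A) (LinearMap.mul' k B) ∘ₗ mid τ

/-! Auxiliary computations. -/

theorem twistedMul_eq (τ : B ⊗[k] A →ₗ[k] A ⊗[k] B) : twistedMul τ = twistedAct A B τ := by
  have hA : LinearMap.mul' k A = act k A A := by ext; simp [act]
  have hB : LinearMap.mul' k B = act k B B := by ext; simp [act]
  rw [twistedMul, twistedAct, hA, hB]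

variable (k) in
theorem mid_apply_aux {W X Y Y' X' Z : Type*} [AddCommGroup W] [Module k W] [AddCommGroup X]
    [Module k X] [AddCommGroup Y] [Module k Y] [AddCommGroup Y'] [Module k Y'] [AddCommGroup X']
    [Module k X'] [AddCommGroup Z] [Module k Z] (f : X ⊗[k] Y →ₗ[k] Y' ⊗[k] X')
    (w : W) (x : X) (y : Y) (z : Z) :
    mid f ((w ⊗ₜ[k] x) ⊗ₜ[k] (y ⊗ₜ[k] z)) =
      TensorProduct.map (TensorProduct.mk k W Y' w) ((TensorProduct.mk k X' Z).flip z)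
        (f (x ⊗ₜ[k] y)) := by
  simp only [mid, LinearMap.comp_apply, LinearEquiv.coe_coe, TensorProduct.assoc_tmul,
    LinearMap.lTensor_tmul, TensorProduct.assoc_symm_tmul, LinearMap.rTensor_tmul]
  induction f (x ⊗ₜ[k] y) with
  | zero => simp
  | tmul a b => simp
  | add a b ha hb => simp only [map_add, TensorProduct.add_tmul, TensorProduct.tmul_add, ha, hb]

theorem twistedAct_tmul (T : B ⊗[k] M →ₗ[k] M ⊗[k] B) (a : A) (b : B) (m : M) (x : N) :
    twistedAct A N T ((a ⊗ₜ[k] b) ⊗ₜ[k] (m ⊗ₜ[k] x)) =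
      TensorProduct.map (Algebra.lsmul k k M a)
        ((Algebra.lsmul k k N).toLinearMap.flip x) (T (b ⊗ₜ[k] m)) := by
  rw [twistedAct, LinearMap.comp_apply, mid_apply_aux]
  induction T (b ⊗ₜ[k] m) with
  | zero => simp
  | tmul u v => simp [act]
  | add u v hu hv => simp only [map_add, hu, hv]

theorem twistedAct_left (T : B ⊗[k] M →ₗ[k] M ⊗[k] B) (a a' : A) (b : B) (z : M ⊗[k] N) :
    twistedAct A N T (((a * a') ⊗ₜ[k] b) ⊗ₜ[k] z) =
      LinearMap.rTensor N (Algebra.lsmul k k M a) (twistedAct A N T ((a' ⊗ₜ[k] b) ⊗ₜ[k] z)) := by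
  induction z with
  | zero => simp
  | add u v hu hv => simp only [map_add, TensorProduct.tmul_add, hu, hv]
  | tmul m x =>
    rw [twistedAct_tmul, twistedAct_tmul]
    induction T (b ⊗ₜ[k] m) with
    | zero => simp
    | tmul u v => simp
    | add u v hu hv => simp only [map_add, hu, hv]

theorem twistedAct_mulRight {τ : B ⊗[k] A →ₗ[k] A ⊗[k] B} {T : B ⊗[k] M →ₗ[k] M ⊗[k] B}
    (h : IsCompatible τ T) (a : A) (b b' : B) (z : M ⊗[k] N) :
    twistedAct A N T ((a ⊗ₜ[k] (b * b')) ⊗ₜ[k] z) =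
      twistedAct A N T ((a ⊗ₜ[k] b) ⊗ₜ[k] twistedAct A N T ((1 ⊗ₜ[k] b') ⊗ₜ[k] z)) := by
  induction z with
  | zero => simp
  | add u v hu hv => simp only [map_add, TensorProduct.tmul_add, hu, hv]
  | tmul m x =>
    have h1 := LinearMap.congr_fun h.mul ((b ⊗ₜ[k] b') ⊗ₜ[k] m)
    simp only [LinearMap.comp_apply, LinearMap.rTensor_tmul, LinearMap.mul'_apply,
      LinearEquiv.coe_coe, TensorProduct.assoc_tmul, LinearMap.lTensor_tmul] at h1
    rw [twistedAct_tmul, twistedAct_tmul, h1]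
    induction T (b' ⊗ₜ[k] m) with
    | zero => simp
    | add u v hu hv => simp only [map_add, TensorProduct.tmul_add, hu, hv]
    | tmul m' b'' =>
      simp only [TensorProduct.assoc_symm_tmul, LinearMap.rTensor_tmul, TensorProduct.map_tmul,
        map_one, Module.End.one_apply, LinearMap.flip_apply, AlgHom.toLinearMap_apply,
        Algebra.lsmul_coe, twistedAct_tmul]
      induction T (b ⊗ₜ[k] m') with
      | zero => simp
      | add u v hu hv => simp only [map_add, TensorProduct.add_tmul, hu, hv]
      | tmul u v => simp

theorem twistedAct_comm {τ : B ⊗[k] A →ₗ[k] A ⊗[k] B} {T : B ⊗[k] M →ₗ[k] M ⊗[k] B}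
    (h : IsCompatible τ T) (a : A) (b : B) (z : M ⊗[k] N) :
    twistedAct A N T ((1 ⊗ₜ[k] b) ⊗ₜ[k] LinearMap.rTensor N (Algebra.lsmul k k M a) z) =
      twistedAct A N T (τ (b ⊗ₜ[k] a) ⊗ₜ[k] z) := by
  induction z with
  | zero => simp
  | add u v hu hv => simp only [map_add, TensorProduct.tmul_add, hu, hv]
  | tmul m x =>
    have h1 := LinearMap.congr_fun h.act (b ⊗ₜ[k] (a ⊗ₜ[k] m))
    simp only [LinearMap.comp_apply, LinearMap.rTensor_tmul, LinearEquiv.coe_coe,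
      TensorProduct.assoc_symm_tmul, LinearMap.lTensor_tmul, TruncOre.act, TensorProduct.lift.tmul,
      AlgHom.toLinearMap_apply, Algebra.lsmul_coe] at h1
    simp only [LinearMap.rTensor_tmul, Algebra.lsmul_coe]
    rw [twistedAct_tmul, h1]
    induction τ (b ⊗ₜ[k] a) with
    | zero => simp
    | add u v hu hv => simp only [map_add, TensorProduct.add_tmul, hu, hv]
    | tmul a' b' =>
      simp only [TensorProduct.assoc_tmul, LinearMap.lTensor_tmul, twistedAct_tmul]
      induction T (b' ⊗ₜ[k] m) with
      | zero => simp
      | add u v hu hv => simp only [map_add, TensorProduct.tmul_add, hu, hv]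
      | tmul u v => simp

theorem twistedAct_one {τ : B ⊗[k] A →ₗ[k] A ⊗[k] B} {T : B ⊗[k] M →ₗ[k] M ⊗[k] B}
    (h : IsCompatible τ T) (z : M ⊗[k] N) :
    twistedAct A N T ((1 ⊗ₜ[k] 1) ⊗ₜ[k] z) = z := by
  have key : ∀ w : M ⊗[k] B, twistedAct A B T ((1 ⊗ₜ[k] 1) ⊗ₜ[k] w) = w := by
    intro w
    obtain ⟨y, rfl⟩ := h.bijective.2 w
    induction y with
    | zero => simp
    | add u v hu hv => simp only [map_add, TensorProduct.tmul_add, hu, hv]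
    | tmul b m =>
      have e : ∀ b : B, T (b ⊗ₜ[k] m) =
          twistedAct A B T ((1 ⊗ₜ[k] b) ⊗ₜ[k] (m ⊗ₜ[k] (1 : B))) := by
        intro b
        rw [twistedAct_tmul]
        induction T (b ⊗ₜ[k] m) with
        | zero => simp
        | add u v hu hv => simp only [map_add, ← hu, ← hv]
        | tmul u v => simp
      rw [e b, ← twistedAct_mulRight h, one_mul]
  have key2 : ∀ m : M, T ((1 : B) ⊗ₜ[k] m) = m ⊗ₜ[k] 1 := by
    intro m
    rw [← key (m ⊗ₜ[k] 1), twistedAct_tmul]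
    induction T (1 ⊗ₜ[k] m) with
    | zero => simp
    | add u v hu hv => simp only [map_add, ← hu, ← hv]
    | tmul u v => simp
  induction z with
  | zero => simp
  | add u v hu hv => simp only [map_add, TensorProduct.tmul_add, hu, hv]
  | tmul m x => rw [twistedAct_tmul, key2]; simp

theorem twistedAct_mul {τ : B ⊗[k] A →ₗ[k] A ⊗[k] B} {T : B ⊗[k] M →ₗ[k] M ⊗[k] B}
    (h : IsCompatible τ T) (e e' : A ⊗[k] B) (z : M ⊗[k] N) :
    twistedAct A N T (twistedMul τ (e ⊗ₜ[k] e') ⊗ₜ[k] z) =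
      twistedAct A N T (e ⊗ₜ[k] twistedAct A N T (e' ⊗ₜ[k] z)) := by
  induction e with
  | zero => simp
  | add u v hu hv => simp only [map_add, TensorProduct.add_tmul, hu, hv]
  | tmul a b =>
  induction e' with
  | zero => simp
  | add u v hu hv => simp only [map_add, TensorProduct.tmul_add, TensorProduct.add_tmul, hu, hv]
  | tmul a' b' =>
    have h2 : twistedAct A N T ((a' ⊗ₜ[k] b') ⊗ₜ[k] z) =
        LinearMap.rTensor N (Algebra.lsmul k k M a')
          (twistedAct A N T ((1 ⊗ₜ[k] b') ⊗ₜ[k] z)) := by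
      rw [← twistedAct_left, mul_one]
    have h3 : ∀ w : M ⊗[k] N, twistedAct A N T ((a ⊗ₜ[k] b) ⊗ₜ[k] w) =
        LinearMap.rTensor N (Algebra.lsmul k k M a)
          (twistedAct A N T ((1 ⊗ₜ[k] b) ⊗ₜ[k] w)) := by
      intro w; rw [← twistedAct_left, mul_one]
    rw [h2, h3, twistedAct_comm h, twistedMul_eq, twistedAct_tmul]
    induction τ (b ⊗ₜ[k] a') with
    | zero => simp
    | add u v hu hv => simp only [map_add, TensorProduct.add_tmul, hu, hv]
    | tmul u v =>
      simp only [TensorProduct.map_tmul, Algebra.lsmul_coe, smul_eq_mul, LinearMap.flip_apply,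
        AlgHom.toLinearMap_apply]
      rw [twistedAct_left, twistedAct_mulRight h]

/-- A twisting map makes the regular module `A` compatible. -/
theorem IsTwistingMap.isCompatible {τ : B ⊗[k] A →ₗ[k] A ⊗[k] B} (h : IsTwistingMap τ) :
    IsCompatible τ τ where
  bijective := h.bijective
  mul := by
    ext b b' a
    have h1 := LinearMap.congr_fun h.mul ((b ⊗ₜ[k] b') ⊗ₜ[k] (a ⊗ₜ[k] 1))
    simp only [LinearMap.comp_apply, TensorProduct.map_tmul, LinearMap.mul'_apply, mul_one,
      mid_apply_aux] at h1
    simp only [TensorProduct.AlgebraTensorModule.curry_apply, LinearMap.restrictScalars_self,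
      TensorProduct.curry_apply, LinearMap.comp_apply, LinearMap.rTensor_tmul,
      LinearMap.mul'_apply, LinearEquiv.coe_coe, TensorProduct.assoc_tmul,
      LinearMap.lTensor_tmul]
    rw [h1]
    induction τ (b' ⊗ₜ[k] a) with
    | zero => simp
    | add u v hu hv => simp only [map_add, TensorProduct.tmul_add, hu, hv]
    | tmul u v =>
      simp only [TensorProduct.map_tmul, TensorProduct.mk_apply, LinearMap.flip_apply, h.tmul_one,
        TensorProduct.assoc_symm_tmul, LinearMap.rTensor_tmul]
      induction τ (b ⊗ₜ[k] u) with
      | zero => simp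
      | add u v hu hv => simp only [map_add, TensorProduct.add_tmul, hu, hv]
      | tmul u' v' => simp [mid_apply_aux, h.tmul_one]
  act := by
    ext b a a'
    have h1 := LinearMap.congr_fun h.mul ((1 ⊗ₜ[k] b) ⊗ₜ[k] (a ⊗ₜ[k] a'))
    simp only [LinearMap.comp_apply, TensorProduct.map_tmul, LinearMap.mul'_apply, one_mul,
      mid_apply_aux] at h1
    simp only [TensorProduct.AlgebraTensorModule.curry_apply, LinearMap.restrictScalars_self,
      TensorProduct.curry_apply, LinearMap.comp_apply, LinearMap.rTensor_tmul,
      LinearEquiv.coe_coe, TensorProduct.assoc_symm_tmul, LinearMap.lTensor_tmul, TruncOre.act,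
      TensorProduct.lift.tmul, AlgHom.toLinearMap_apply, Algebra.lsmul_coe, smul_eq_mul]
    rw [h1]
    induction τ (b ⊗ₜ[k] a) with
    | zero => simp
    | add u v hu hv => simp only [map_add, TensorProduct.add_tmul, hu, hv]
    | tmul u v =>
      simp only [TensorProduct.map_tmul, TensorProduct.mk_apply, LinearMap.flip_apply, h.one_tmul,
        TensorProduct.assoc_tmul, LinearMap.lTensor_tmul]
      induction τ (v ⊗ₜ[k] a') with
      | zero => simp
      | add u v hu hv => simp only [map_add, TensorProduct.tmul_add, hu, hv]
      | tmul u' v' => simp [mid_apply_aux, h.one_tmul]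

/-- The twisted tensor product algebra `A ⊗_τ B`: the vector space `A ⊗ B` with the
multiplication `(m_A ⊗ m_B) ∘ (1 ⊗ τ ⊗ 1)`. -/
def TwistedTensor {τ : B ⊗[k] A →ₗ[k] A ⊗[k] B} (_ : IsTwistingMap τ) : Type _ := A ⊗[k] B

namespace TwistedTensor

variable {τ : B ⊗[k] A →ₗ[k] A ⊗[k] B} (h : IsTwistingMap τ)

instance : AddCommGroup (TwistedTensor h) := inferInstanceAs (AddCommGroup (A ⊗[k] B))

instance : Module k (TwistedTensor h) := inferInstanceAs (Module k (A ⊗[k] B))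

/-- The identification of the underlying vector space of `A ⊗_τ B` with `A ⊗ B`. -/
def equiv : TwistedTensor h ≃ₗ[k] A ⊗[k] B := LinearEquiv.refl k (A ⊗[k] B)

/-- The element `a ⊗ b` of `A ⊗_τ B`. -/
def tmul (a : A) (b : B) : TwistedTensor h := (equiv h).symm (a ⊗ₜ[k] b)

instance : Mul (TwistedTensor h) where
  mul e e' := (equiv h).symm (twistedMul τ (equiv h e ⊗ₜ[k] equiv h e'))

instance : One (TwistedTensor h) where
  one := tmul h 1 1

theorem equiv_mul (e e' : TwistedTensor h) :
    equiv h (e * e') = twistedMul τ (equiv h e ⊗ₜ[k] equiv h e') :=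
  (equiv h).apply_symm_apply _

theorem equiv_one : equiv h 1 = 1 ⊗ₜ[k] 1 := (equiv h).apply_symm_apply _

instance : Ring (TwistedTensor h) :=
  { (inferInstance : AddCommGroup (TwistedTensor h)),
    (inferInstance : Mul (TwistedTensor h)), (inferInstance : One (TwistedTensor h)) with
    left_distrib := fun a b c => (equiv h).injective (by
      simp only [map_add, equiv_mul, TensorProduct.tmul_add])
    right_distrib := fun a b c => (equiv h).injective (by
      simp only [map_add, equiv_mul, TensorProduct.add_tmul])
    zero_mul := fun a => (equiv h).injective (by
      simp only [map_zero, equiv_mul, TensorProduct.zero_tmul])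
    mul_zero := fun a => (equiv h).injective (by
      simp only [map_zero, equiv_mul, TensorProduct.tmul_zero])
    mul_assoc := fun a b c => (equiv h).injective (by
      have := twistedAct_mul (N := B) h.isCompatible (equiv h a) (equiv h b) (equiv h c)
      simpa only [equiv_mul, ← twistedMul_eq] using this)
    one_mul := fun a => (equiv h).injective (by
      rw [equiv_mul, equiv_one, twistedMul_eq, twistedAct_one h.isCompatible])
    mul_one := fun a => (equiv h).injective (by
      rw [equiv_mul, equiv_one, twistedMul_eq]
      induction equiv h a with
      | zero => simp
      | add u v hu hv => rw [TensorProduct.add_tmul, map_add, hu, hv]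
      | tmul u v => rw [twistedAct_tmul, h.tmul_one]; simp) }

instance : Algebra k (TwistedTensor h) :=
  Algebra.ofModule
    (fun c e e' => (equiv h).injective (by
      simp only [equiv_mul, map_smul, ← TensorProduct.smul_tmul']))
    (fun c e e' => (equiv h).injective (by
      simp only [equiv_mul, map_smul, TensorProduct.tmul_smul]))

end TwistedTensor

/-- The left `A ⊗_τ B`-module with underlying space `M ⊗ N`, for a left `A`-module `M` compatible
with `τ` via `T` and a left `B`-module `N`. -/
def TwistedProd {τ : B ⊗[k] A →ₗ[k] A ⊗[k] B} (_ : IsTwistingMap τ)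
    {M : Type*} [AddCommGroup M] [Module k M] [Module A M] [IsScalarTower k A M]
    {T : B ⊗[k] M →ₗ[k] M ⊗[k] B} (_ : IsCompatible τ T)
    (N : Type*) [AddCommGroup N] [Module k N] : Type _ := M ⊗[k] N

namespace TwistedProd

variable {τ : B ⊗[k] A →ₗ[k] A ⊗[k] B} (h : IsTwistingMap τ) {T : B ⊗[k] M →ₗ[k] M ⊗[k] B}
  (hT : IsCompatible τ T) (N)

instance : AddCommGroup (TwistedProd h hT N) := inferInstanceAs (AddCommGroup (M ⊗[k] N))

instance : Module k (TwistedProd h hT N) := inferInstanceAs (Module k (M ⊗[k] N))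

/-- The identification of the underlying vector space with `M ⊗ N`. -/
def equiv : TwistedProd h hT N ≃ₗ[k] M ⊗[k] N := LinearEquiv.refl k (M ⊗[k] N)

/-- The action of `A ⊗_τ B` on `M ⊗ N` by `(ρ_A ⊗ ρ_B) ∘ (1 ⊗ T ⊗ 1)`. -/
instance : SMul (TwistedTensor h) (TwistedProd h hT N) where
  smul e z := (equiv N h hT).symm
    (twistedAct A N T (TwistedTensor.equiv h e ⊗ₜ[k] equiv N h hT z))

theorem equiv_smul (e : TwistedTensor h) (z : TwistedProd h hT N) :
    equiv N h hT (e • z) =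
      twistedAct A N T (TwistedTensor.equiv h e ⊗ₜ[k] equiv N h hT z) :=
  (equiv N h hT).apply_symm_apply _

instance : Module (TwistedTensor h) (TwistedProd h hT N) where
  one_smul z := (equiv N h hT).injective (by
    rw [equiv_smul, TwistedTensor.equiv_one, twistedAct_one hT])
  mul_smul e e' z := (equiv N h hT).injective (by
    rw [equiv_smul, equiv_smul, equiv_smul, TwistedTensor.equiv_mul, twistedAct_mul hT])
  smul_zero e := (equiv N h hT).injective (by
    simp only [equiv_smul, map_zero, TensorProduct.tmul_zero])
  smul_add e z z' := (equiv N h hT).injective (by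
    simp only [equiv_smul, map_add, TensorProduct.tmul_add])
  add_smul e e' z := (equiv N h hT).injective (by
    simp only [equiv_smul, map_add, TensorProduct.add_tmul])
  zero_smul z := (equiv N h hT).injective (by
    simp only [equiv_smul, map_zero, TensorProduct.zero_tmul])

end TwistedProd

end Twisting

/-! ### Resolutions -/

section Resolutions

/-- `⋯ → P 1 → P 0 → M → 0` is a resolution of `M` by free `R`-modules. -/
structure IsFreeResolution {R M : Type*} [Ring R] [AddCommGroup M] [Module R M]
    {P : ℕ → Type*} [∀ i, AddCommGroup (P i)] [∀ i, Module R (P i)]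
    (d : ∀ i, P (i + 1) →ₗ[R] P i) (μ : P 0 →ₗ[R] M) : Prop where
  free : ∀ i, Module.Free R (P i)
  surjective : Function.Surjective μ
  exact_zero : Function.Exact (d 0) μ
  exact_succ : ∀ i, Function.Exact (d (i + 1)) (d i)

/-- The additive maps `⋯ → X 1 → X 0 → M → 0` are `R`-linear and form a resolution of `M` by
projective `R`-modules. -/
structure IsProjectiveResolution (R : Type*) {M : Type*} [Ring R] [AddCommGroup M] [Module R M]
    {X : ℕ → Type*} [∀ i, AddCommGroup (X i)] [∀ i, Module R (X i)]
    (d : ∀ i, X (i + 1) →+ X i) (μ : X 0 →+ M) : Prop where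
  map_smul : ∀ (i : ℕ) (r : R) (x : X (i + 1)), d i (r • x) = r • d i x
  aug_smul : ∀ (r : R) (x : X 0), μ (r • x) = r • μ x
  projective : ∀ i, Module.Projective R (X i)
  surjective : Function.Surjective μ
  exact_zero : Function.Exact (d 0) μ
  exact_succ : ∀ i, Function.Exact (d (i + 1)) (d i)

variable {k A B M : Type*} [CommRing k] [Ring A] [Algebra k A] [Ring B] [Algebra k B]
  [AddCommGroup M] [Module k M] [Module A M] [IsScalarTower k A M]
  {P : ℕ → Type*} [∀ i, AddCommGroup (P i)] [∀ i, Module k (P i)] [∀ i, Module A (P i)]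
  [∀ i, IsScalarTower k A (P i)]

/-- The complex `P` of `A`-modules augmented to `M` is compatible with `τ` via the maps
`T i : B ⊗ P i → P i ⊗ B`, which form a chain map lifting `T_M : B ⊗ M → M ⊗ B`. -/
structure IsCompatibleResolution (τ : B ⊗[k] A →ₗ[k] A ⊗[k] B)
    (d : ∀ i, P (i + 1) →ₗ[A] P i) (μ : P 0 →ₗ[A] M)
    (TM : B ⊗[k] M →ₗ[k] M ⊗[k] B) (T : ∀ i, B ⊗[k] P i →ₗ[k] P i ⊗[k] B) : Prop where
  compatible : ∀ i, IsCompatible τ (T i)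
  chain : ∀ i, T i ∘ₗ LinearMap.lTensor B ((d i).restrictScalars k) =
    LinearMap.rTensor B ((d i).restrictScalars k) ∘ₗ T (i + 1)
  lifts : TM ∘ₗ LinearMap.lTensor B (μ.restrictScalars k) =
    LinearMap.rTensor B (μ.restrictScalars k) ∘ₗ T 0

variable {τ : B ⊗[k] A →ₗ[k] A ⊗[k] B} (h : IsTwistingMap τ)
  {T : ∀ i, B ⊗[k] P i →ₗ[k] P i ⊗[k] B} (hT : ∀ i, IsCompatible τ (T i))
  (Q : ℕ → Type*) [∀ j, AddCommGroup (Q j)] [∀ j, Module k (Q j)] [∀ j, Module B (Q j)]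
  [∀ j, IsScalarTower k B (Q j)]

/-- The `m`-th term `⨁_{i + j = m} P i ⊗ Q j` of the twisted product complex; the direct sum is
finite, so it is the product over the pairs `(i, j)`, with the componentwise action. -/
abbrev TwistedComplex (m : ℕ) : Type _ :=
  ∀ p : {p : ℕ × ℕ // p.1 + p.2 = m}, TwistedProd h (hT p.1.1) (Q p.1.2)

/-- The component in `P i ⊗ Q j`, for `i + j = m`, of an element of `TwistedComplex h hT Q m`. -/
def TwistedComplex.proj {m : ℕ} (i j : ℕ) (hij : i + j = m) :
    TwistedComplex h hT Q m →+ P i ⊗[k] Q j :=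
  (TwistedProd.equiv (Q j) h (hT i)).toLinearMap.toAddMonoidHom.comp
    (Pi.evalAddMonoidHom
      (fun p : {p : ℕ × ℕ // p.1 + p.2 = m} => TwistedProd h (hT p.1.1) (Q p.1.2)) ⟨(i, j), hij⟩)

variable {Q}

/-- The differential of the twisted product complex: on `P i ⊗ Q j` it is
`d' ⊗ 1 + (-1)^i (1 ⊗ d'')`. Its component in `P i ⊗ Q j` collects the contributions of
`P (i + 1) ⊗ Q j` and of `P i ⊗ Q (j + 1)`. -/
def TwistedComplex.d (d' : ∀ i, P (i + 1) →ₗ[A] P i) (d'' : ∀ j, Q (j + 1) →ₗ[B] Q j) (m : ℕ) :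
    TwistedComplex h hT Q (m + 1) →+ TwistedComplex h hT Q m :=
  AddMonoidHom.mk' (fun z p => (TwistedProd.equiv (Q p.1.2) h (hT p.1.1)).symm
    (LinearMap.rTensor (Q p.1.2) ((d' p.1.1).restrictScalars k)
        (proj h hT Q (p.1.1 + 1) p.1.2 (by have := p.2; omega) z)
      + (-1 : k) ^ p.1.1 • LinearMap.lTensor (P p.1.1) ((d'' p.1.2).restrictScalars k)
        (proj h hT Q p.1.1 (p.1.2 + 1) (by have := p.2; omega) z)))
    (fun z z' => by
      funext p
      simp only [map_add, smul_add, Pi.add_apply]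
      abel)

/-- The augmentation `μ ⊗ ν : P 0 ⊗ Q 0 → M ⊗ N` of the twisted product complex. -/
def TwistedComplex.aug {N : Type*} [AddCommGroup N] [Module k N] (μ : P 0 →ₗ[A] M)
    (ν : Q 0 →ₗ[k] N) : TwistedComplex h hT Q 0 →+ M ⊗[k] N :=
  (TensorProduct.map (μ.restrictScalars k) ν).toAddMonoidHom.comp (proj h hT Q 0 0 rfl)

end Resolutions

/-! ### Truncated polynomials and truncated Ore extensions -/

section Ore

/-- The algebra `k[x]/(x^n)`. -/
abbrev TruncPoly (k : Type*) [Field k] (n : ℕ) : Type _ := AdjoinRoot (Polynomial.X ^ n : k[X])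

variable {k : Type*} [Field k] {n : ℕ}

variable (k n) in
/-- The class `x̄` of `x` in `k[x]/(x^n)`. -/
abbrev xbar : TruncPoly k n := AdjoinRoot.root (Polynomial.X ^ n : k[X])

/-- The augmentation `ε : k[x]/(x^n) → k`, `x̄ ↦ 0`. -/
def augmentation (hn : 2 ≤ n) : TruncPoly k n →ₐ[k] k :=
  AdjoinRoot.liftAlgHom (Polynomial.X ^ n) (Algebra.ofId k k) 0
    (by simp [show n ≠ 0 by omega])

variable (k n) in
/-- The differentials `⋯ → B → B → B` of the standard periodic resolution of `k` over
`B = k[x]/(x^n)`: multiplication by `x̄`, `x̄^(n-1)`, `x̄`, … in degrees `1`, `2`, `3`, …. -/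
def stdDiff (j : ℕ) : TruncPoly k n →ₗ[TruncPoly k n] TruncPoly k n :=
  LinearMap.mulLeft (TruncPoly k n) (if Even j then xbar k n else xbar k n ^ (n - 1))

variable {V : Type*} [AddCommGroup V] [Module k V]

/-- The operator `v ⊗ b ↦ s v ⊗ x̄ b + d v ⊗ b` on `V ⊗ k[x]/(x^n)`. -/
def oreStep (n : ℕ) (s d : V →ₗ[k] V) : Module.End k (V ⊗[k] TruncPoly k n) :=
  TensorProduct.map s (LinearMap.mulLeft k (xbar k n)) + LinearMap.rTensor (TruncPoly k n) d

/-- The `k`-linear map `T : k[x]/(x^n) ⊗ V → V ⊗ k[x]/(x^n)` with `T (1 ⊗ v) = v ⊗ 1`,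
`T (x̄ ⊗ v) = s v ⊗ x̄ + d v ⊗ 1`, and, for `l + 1 < n`,
`T (x̄ ^ (l + 1) ⊗ v) = (1 ⊗ m) (T ⊗ 1) (1 ⊗ T) (x̄ ⊗ x̄ ^ l ⊗ v)`. So `T (x̄ ^ l ⊗ v)`, for
`l < n`, is the `l`-th iterate of `oreStep n s d` at `v ⊗ 1`: see `oreMap_pow`. -/
def oreMap (n : ℕ) (s d : V →ₗ[k] V) : TruncPoly k n ⊗[k] V →ₗ[k] V ⊗[k] TruncPoly k n :=
  TensorProduct.lift
    (LinearMap.lcomp k (V ⊗[k] TruncPoly k n) ((TensorProduct.mk k V (TruncPoly k n)).flip 1)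
      ∘ₗ (Polynomial.aeval (oreStep n s d)).toLinearMap
      ∘ₗ AdjoinRoot.modByMonicHom (Polynomial.monic_X_pow n))

theorem oreMap_pow (s d : V →ₗ[k] V) {l : ℕ} (hl : l < n) (v : V) :
    oreMap n s d ((xbar k n ^ l) ⊗ₜ[k] v) = (oreStep n s d ^ l) (v ⊗ₜ[k] 1) := by
  have h : AdjoinRoot.modByMonicHom (Polynomial.monic_X_pow n) (xbar k n ^ l) =
      (Polynomial.X ^ l : k[X]) := by
    rw [xbar, AdjoinRoot.root, ← map_pow, AdjoinRoot.modByMonicHom_mk,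
      Polynomial.modByMonic_eq_self_iff (Polynomial.monic_X_pow n)]
    simpa using hl
  simp [oreMap, h]

/-- `δ` is a left `σ`-derivation of `A`. -/
def IsSigmaDerivation {A : Type*} [Ring A] [Algebra k A] (σ : A ≃ₐ[k] A) (δ : A →ₗ[k] A) : Prop :=
  ∀ a a' : A, δ (a * a') = δ a * a' + σ a * δ a'

/-- The condition for `A[x̄; σ, δ] = A ⊗_τ k[x]/(x^n)` to be a truncated Ore extension: `δ` is a left
`σ`-derivation and the map `τ` induced by the relation `x̄ a = σ a x̄ + δ a` is a twisting map. -/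
structure IsTruncatedOre (n : ℕ) {A : Type*} [Ring A] [Algebra k A] (σ : A ≃ₐ[k] A)
    (δ : A →ₗ[k] A) : Prop where
  leibniz : IsSigmaDerivation σ δ
  twisting : IsTwistingMap (oreMap n σ.toLinearMap δ)

/-- The truncated Ore extension `A[x̄; σ, δ] = A ⊗_τ k[x]/(x^n)`. -/
abbrev OreExt {A : Type*} [Ring A] [Algebra k A] {σ : A ≃ₐ[k] A} {δ : A →ₗ[k] A}
    (h : IsTruncatedOre n σ δ) : Type _ := TwistedTensor h.twisting

/-- Multiplication by `x̄` on an `A[x̄; σ, δ]`-module. -/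
def xAct {A : Type*} [Ring A] [Algebra k A] {σ : A ≃ₐ[k] A} {δ : A →ₗ[k] A}
    (h : IsTruncatedOre n σ δ) (M : Type*) [AddCommGroup M] [Module k M] [Module (OreExt h) M]
    [IsScalarTower k (OreExt h) M] : M →ₗ[k] M :=
  Algebra.lsmul k k M (TwistedTensor.tmul h.twisting 1 (xbar k n))

end Ore

end

end TruncOre

/-!
Write `R = A ⊗_τ B` with `B = k[x]/(x^n)`. Three facts make the twisted product complex a projective
resolution of `M`.

*Projectivity.* If `(e j)` is an `A`-basis of `P i`, then `(e j ⊗ 1)` is an `R`-basis of `P i ⊗ B`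
(`free_twistedProd`). Sending the free module on the `e j` to `P i ⊗ B` amounts, after identifying
`⨁ R` with `⨁ B ⊗ A = B ⊗ P i` by means of the bijection `τ`, to applying the twisting
`T i : B ⊗ P i → P i ⊗ B`, which is bijective. So every `X m` is even free.

*Linearity.* The twisted action on `M ⊗ N` is natural in `N` for `B`-linear maps and in `M` for
`A`-linear maps that intertwine the twistings (`twistedAct_lTensor`, `twistedAct_rTensor`).
For the augmentation, `μ ⊗ 1` is natural in this sense because the `T i` lift the twisting of `M`,
and `1 ⊗ ε : M ⊗ B → M` is `R`-linear because setting `x̄ = 0` in the iterates of `φ ⊗ x̄ + f ⊗ 1`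
leaves the iterates of the action `f` of `x̄` (`rid_augmentation_twistedAct`).

*Exactness.* This concerns the underlying `k`-spaces only. The standard resolution of `k` has a
`k`-linear contracting homotopy `s` (`stdHomotopy`), and `(-1)^i (1 ⊗ s)` contracts the total
complex onto `P ⊗ k`, whose homology is `M` (`TwistedComplex.exists_d_eq`).
-/

namespace TruncOre

/-! ### The twisted action: naturality and freeness -/

section TwistedProduct

variable {k A B : Type*} [CommRing k] [Ring A] [Algebra k A] [Ring B] [Algebra k B]
  {M M' N N' : Type*} [AddCommGroup M] [Module k M] [Module A M] [IsScalarTower k A M]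
  [AddCommGroup M'] [Module k M'] [Module A M'] [IsScalarTower k A M']
  [AddCommGroup N] [Module k N] [Module B N] [IsScalarTower k B N]
  [AddCommGroup N'] [Module k N'] [Module B N'] [IsScalarTower k B N']

/-- `f ⊗ 1` commutes with the twisted action as soon as the `A`-linear map `f` intertwines the
maps `T` and `T'` through which the action is twisted. -/
theorem twistedAct_rTensor {T : B ⊗[k] M →ₗ[k] M ⊗[k] B} {T' : B ⊗[k] M' →ₗ[k] M' ⊗[k] B}
    (f : M →ₗ[A] M')
    (hf : T' ∘ₗ LinearMap.lTensor B (f.restrictScalars k) =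
      LinearMap.rTensor B (f.restrictScalars k) ∘ₗ T) (e : A ⊗[k] B) (z : M ⊗[k] N) :
    twistedAct A N T' (e ⊗ₜ[k] LinearMap.rTensor N (f.restrictScalars k) z) =
      LinearMap.rTensor N (f.restrictScalars k) (twistedAct A N T (e ⊗ₜ[k] z)) := by
  induction e with
  | zero => simp
  | add u v hu hv => simp only [map_add, TensorProduct.add_tmul, hu, hv]
  | tmul a b =>
  induction z with
  | zero => simp
  | add u v hu hv => simp only [map_add, TensorProduct.tmul_add, hu, hv]
  | tmul m x =>
    have h1 := LinearMap.congr_fun hf (b ⊗ₜ[k] m)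
    simp only [LinearMap.comp_apply, LinearMap.lTensor_tmul, LinearMap.coe_restrictScalars] at h1
    simp only [LinearMap.rTensor_tmul, LinearMap.coe_restrictScalars, twistedAct_tmul, h1]
    induction T (b ⊗ₜ[k] m) with
    | zero => simp
    | tmul u v => simp
    | add u v hu hv => simp only [map_add, hu, hv]

theorem twistedAct_lTensor (T : B ⊗[k] M →ₗ[k] M ⊗[k] B) (g : N →ₗ[B] N') (e : A ⊗[k] B)
    (z : M ⊗[k] N) :
    twistedAct A N' T (e ⊗ₜ[k] LinearMap.lTensor M (g.restrictScalars k) z) =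
      LinearMap.lTensor M (g.restrictScalars k) (twistedAct A N T (e ⊗ₜ[k] z)) := by
  induction e with
  | zero => simp
  | add u v hu hv => simp only [map_add, TensorProduct.add_tmul, hu, hv]
  | tmul a b =>
  induction z with
  | zero => simp
  | add u v hu hv => simp only [map_add, TensorProduct.tmul_add, hu, hv]
  | tmul m x =>
    simp only [LinearMap.lTensor_tmul, LinearMap.coe_restrictScalars, twistedAct_tmul]
    induction T (b ⊗ₜ[k] m) with
    | zero => simp
    | tmul u v => simp
    | add u v hu hv => simp only [map_add, hu, hv]

/-- If `(e j)` is an `A`-basis of `M`, then `(e j ⊗ 1)` is a basis of `M ⊗ B` over `A ⊗_τ B`.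
Indeed `τ` identifies the free module on the `e j` with `⨁ B ⊗ A = B ⊗ M`, and under this
identification the linear combination map becomes the bijection `T : B ⊗ M → M ⊗ B`. -/
theorem free_twistedProd {τ : B ⊗[k] A →ₗ[k] A ⊗[k] B} (h : IsTwistingMap τ)
    {T : B ⊗[k] M →ₗ[k] M ⊗[k] B} (hT : IsCompatible τ T) [Module.Free A M] :
    Module.Free (TwistedTensor h) (TwistedProd h hT B) := by
  classical
  let ι := Module.Free.ChooseBasisIndex A M
  let e : Module.Basis ι A M := Module.Free.chooseBasis A M
  let F : (ι →₀ TwistedTensor h) →ₗ[TwistedTensor h] TwistedProd h hT B :=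
    Finsupp.linearCombination _ fun j => (TwistedProd.equiv B h hT).symm (e j ⊗ₜ[k] 1)
  let τ' : B ⊗[k] A ≃ₗ[k] TwistedTensor h :=
    LinearEquiv.ofBijective τ h.bijective ≪≫ₗ (TwistedTensor.equiv h).symm
  let E : B ⊗[k] (ι →₀ A) ≃ₗ[k] (ι →₀ TwistedTensor h) :=
    TensorProduct.finsuppRight k k B A ι ≪≫ₗ Finsupp.mapRange.linearEquiv τ'
  let r : M ≃ₗ[k] (ι →₀ A) := e.repr.restrictScalars k
  have hF : ∀ y : B ⊗[k] (ι →₀ A),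
      TwistedProd.equiv B h hT (F (E y)) = T (LinearMap.lTensor B r.symm.toLinearMap y) := by
    intro y
    induction y with
    | zero => simp
    | add u v hu hv => simp only [map_add, hu, hv]
    | tmul b v =>
      induction v using Finsupp.induction_linear with
      | zero => simp
      | add u v hu hv => simp only [map_add, TensorProduct.tmul_add, hu, hv]
      | single j a =>
        have hE : E (b ⊗ₜ[k] Finsupp.single j a) = Finsupp.single j (τ' (b ⊗ₜ[k] a)) := by
          simp only [E, LinearEquiv.trans_apply, TensorProduct.finsuppRight_tmul_single]
          exact Finsupp.mapRange_single (hf := map_zero τ')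
        have hr : r.symm (Finsupp.single j a) = a • e j := e.repr_symm_single j a
        have hτ : TwistedTensor.equiv h (τ' (b ⊗ₜ[k] a)) = τ (b ⊗ₜ[k] a) := rfl
        have hc := twistedAct_comm (N := B) hT a b (e j ⊗ₜ[k] 1)
        rw [hE, LinearMap.lTensor_tmul, LinearEquiv.coe_coe, hr]
        simp only [F, Finsupp.linearCombination_single]
        rw [TwistedProd.equiv_smul, LinearEquiv.apply_symm_apply, hτ, ← hc,
          LinearMap.rTensor_tmul, twistedAct_tmul, Algebra.lsmul_coe]
        induction T (b ⊗ₜ[k] (a • e j)) with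
        | zero => simp
        | tmul u v => simp
        | add u v hu hv => simp only [map_add, hu, hv]
  have hbij : Function.Bijective F := by
    have h1 : Function.Bijective fun y => TwistedProd.equiv B h hT (F (E y)) := by
      have h2 : (fun y => TwistedProd.equiv B h hT (F (E y))) =
          T ∘ (LinearEquiv.lTensor B r.symm) := funext hF
      rw [h2]
      exact hT.bijective.comp (LinearEquiv.bijective _)
    have h3 : (F : (ι →₀ TwistedTensor h) → TwistedProd h hT B) =
        (TwistedProd.equiv B h hT).symm ∘ (fun y => TwistedProd.equiv B h hT (F (E y)))
          ∘ E.symm := by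
      ext w
      simp
    rw [h3]
    exact (LinearEquiv.bijective _).comp (h1.comp (LinearEquiv.bijective _))
  exact Module.Free.of_equiv (LinearEquiv.ofBijective F hbij)

end TwistedProduct

end TruncOre

namespace TruncOre

/-! ### Exactness of the twisted product complex -/

section Exactness

variable {k A B M : Type*} [CommRing k] [Ring A] [Algebra k A] [Ring B] [Algebra k B]
  [AddCommGroup M] [Module k M] [Module A M] [IsScalarTower k A M]
  {P : ℕ → Type*} [∀ i, AddCommGroup (P i)] [∀ i, Module k (P i)] [∀ i, Module A (P i)]
  [∀ i, IsScalarTower k A (P i)]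
  {τ : B ⊗[k] A →ₗ[k] A ⊗[k] B} (h : IsTwistingMap τ)
  {T : ∀ i, B ⊗[k] P i →ₗ[k] P i ⊗[k] B} (hT : ∀ i, IsCompatible τ (T i))
  {Q : ℕ → Type*} [∀ j, AddCommGroup (Q j)] [∀ j, Module k (Q j)]

namespace TwistedComplex

instance finite_index (m : ℕ) : Finite {p : ℕ × ℕ // p.1 + p.2 = m} :=
  Finite.of_equiv (Finset.HasAntidiagonal.antidiagonal m)
    (Equiv.subtypeEquivRight fun _ => Finset.HasAntidiagonal.mem_antidiagonal)

theorem ext_proj {m : ℕ} {z z' : TwistedComplex h hT Q m}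
    (H : ∀ (i j : ℕ) (hij : i + j = m), proj h hT Q i j hij z = proj h hT Q i j hij z') :
    z = z' := by
  funext p
  obtain ⟨⟨i, j⟩, hij⟩ := p
  exact H i j hij

/-- The element of `⨁_{i + j = m} P i ⊗ Q j` with prescribed components. -/
def ofComponents {m : ℕ} (f : ∀ i j : ℕ, i + j = m → P i ⊗[k] Q j) : TwistedComplex h hT Q m :=
  fun p => (TwistedProd.equiv (Q p.1.2) h (hT p.1.1)).symm (f p.1.1 p.1.2 p.2)

theorem proj_ofComponents {m : ℕ} (f : ∀ i j : ℕ, i + j = m → P i ⊗[k] Q j) (i j : ℕ)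
    (hij : i + j = m) : proj h hT Q i j hij (ofComponents h hT f) = f i j hij := rfl

/-- The augmentation `μ ⊗ ε : X_0 → M ⊗ k = M`, computed through `(1 ⊗ ε) : P 0 ⊗ Q 0 → P 0`. -/
theorem rid_aug (μ : P 0 →ₗ[A] M) (ε : Q 0 →ₗ[k] k)
    (z : TwistedComplex h hT Q 0) :
    TensorProduct.rid k M (aug h hT μ ε z) =
      μ (TensorProduct.rid k (P 0) (LinearMap.lTensor (P 0) ε (proj h hT Q 0 0 rfl z))) := by
  have h1 : aug h hT μ ε z =
      TensorProduct.map (μ.restrictScalars k) ε (proj h hT Q 0 0 rfl z) := rfl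
  rw [h1]
  induction proj h hT Q 0 0 rfl z with
  | zero => simp
  | add a b ha hb => simp only [map_add, ha, hb]
  | tmul a b => simp [LinearMap.map_smul_of_tower]

theorem aug_surjective (μ : P 0 →ₗ[A] M) (ε : Q 0 →ₗ[k] k) (hμ : Function.Surjective μ)
    (q : Q 0) (hq : ε q = 1) : Function.Surjective
      ((TensorProduct.rid k M).toLinearMap.toAddMonoidHom.comp (aug h hT μ ε)) := by
  intro m
  obtain ⟨u, rfl⟩ := hμ m
  let z : TwistedComplex h hT Q 0 := ofComponents h hT fun i j hij =>
    (show 0 = i by omega) ▸ (show 0 = j by omega) ▸ (u ⊗ₜ[k] q : P 0 ⊗[k] Q 0)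
  have hz : proj h hT Q 0 0 rfl z = u ⊗ₜ[k] q := rfl
  have h1 := rid_aug h hT μ ε z
  rw [hz] at h1
  refine ⟨z, h1.trans ?_⟩
  simp [hq]

variable [∀ j, Module B (Q j)] [∀ j, IsScalarTower k B (Q j)]

theorem proj_smul {m : ℕ} (i j : ℕ) (hij : i + j = m) (r : TwistedTensor h)
    (z : TwistedComplex h hT Q m) :
    proj h hT Q i j hij (r • z) =
      twistedAct A (Q j) (T i) (TwistedTensor.equiv h r ⊗ₜ[k] proj h hT Q i j hij z) := rfl

variable (d' : ∀ i, P (i + 1) →ₗ[A] P i) (d'' : ∀ j, Q (j + 1) →ₗ[B] Q j)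

theorem proj_d {m : ℕ} (i j : ℕ) (hij : i + j = m) (z : TwistedComplex h hT Q (m + 1)) :
    proj h hT Q i j hij (d h hT d' d'' m z) =
      LinearMap.rTensor (Q j) ((d' i).restrictScalars k)
          (proj h hT Q (i + 1) j (by omega) z)
        + (-1 : k) ^ i • LinearMap.lTensor (P i) ((d'' j).restrictScalars k)
          (proj h hT Q i (j + 1) (by omega) z) := rfl

theorem d_smul (hd : ∀ i, T i ∘ₗ LinearMap.lTensor B ((d' i).restrictScalars k) =
      LinearMap.rTensor B ((d' i).restrictScalars k) ∘ₗ T (i + 1))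
    (m : ℕ) (r : TwistedTensor h) (z : TwistedComplex h hT Q (m + 1)) :
    d h hT d' d'' m (r • z) = r • d h hT d' d'' m z := by
  refine ext_proj h hT fun i j hij => ?_
  rw [proj_smul, proj_d, proj_d, proj_smul, proj_smul, ← twistedAct_rTensor (d' i) (hd i),
    ← twistedAct_lTensor, TensorProduct.tmul_add, map_add, TensorProduct.tmul_smul, map_smul]

theorem d_d (hd' : ∀ i z, d' i (d' (i + 1) z) = 0) (hd'' : ∀ j z, d'' j (d'' (j + 1) z) = 0)
    (m : ℕ) (z : TwistedComplex h hT Q (m + 1 + 1)) :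
    d h hT d' d'' m (d h hT d' d'' (m + 1) z) = 0 := by
  have h1 : ∀ i, (d' i).restrictScalars k ∘ₗ (d' (i + 1)).restrictScalars k = 0 :=
    fun i => LinearMap.ext (hd' i)
  have h2 : ∀ j, (d'' j).restrictScalars k ∘ₗ (d'' (j + 1)).restrictScalars k = 0 :=
    fun j => LinearMap.ext (hd'' j)
  refine ext_proj h hT fun i j hij => ?_
  simp only [proj_d, map_add, map_smul, smul_add, map_zero]
  simp only [← LinearMap.comp_apply, ← LinearMap.rTensor_comp, ← LinearMap.lTensor_comp, h1, h2,
    LinearMap.rTensor_comp_lTensor, LinearMap.lTensor_comp_rTensor]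
  simp [pow_succ]

/-- A cycle `z` of degree `m` is a boundary once its image `w = (1 ⊗ ε) z` in `P m` is.
Here `s` is a `k`-linear contracting homotopy of `⋯ → Q 1 → Q 0 → k → 0`, with `1 ↦ q` as its
lowest component. The maps `(-1)^i (1 ⊗ s)` form a homotopy from the identity of the twisted product
complex to `z ↦ w ⊗ q`, because their cross terms with `d' ⊗ 1` cancel.
The hypothesis `hz` states that `d z = 0`, and is void for `m = 0`. -/
theorem exists_d_eq (ε : Q 0 →ₗ[k] k) (q : Q 0) (s : ∀ j, Q j →ₗ[k] Q (j + 1))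
    (hs_zero : ∀ x, d'' 0 (s 0 x) + ε x • q = x)
    (hs_succ : ∀ j x, d'' (j + 1) (s (j + 1) x) + s j (d'' j x) = x)
    {m : ℕ} (z : TwistedComplex h hT Q m)
    (hz : ∀ (i j : ℕ) (hi : i + 1 + j = m) (hj : i + (j + 1) = m),
      LinearMap.rTensor (Q j) ((d' i).restrictScalars k) (proj h hT Q (i + 1) j hi z)
        + (-1 : k) ^ i • LinearMap.lTensor (P i) ((d'' j).restrictScalars k)
          (proj h hT Q i (j + 1) hj z) = 0)
    (u : P (m + 1))
    (hu : d' m u = TensorProduct.rid k (P m)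
      (LinearMap.lTensor (P m) ε (proj h hT Q m 0 rfl z))) :
    ∃ y, d h hT d' d'' m y = z := by
  -- `y = ± (1 ⊗ s) z + u ⊗ q`: the first summand lives in the components with `j > 0`, the second
  -- in the one with `j = 0`.
  let y : ∀ i j : ℕ, i + j = m + 1 → P i ⊗[k] Q j := fun i j =>
    match j with
    | 0 => fun hij => (show m + 1 = i from hij.symm) ▸ (u ⊗ₜ[k] q : P (m + 1) ⊗[k] Q 0)
    | j + 1 => fun hij => (-1 : k) ^ i •
        LinearMap.lTensor (P i) (s j) (proj h hT Q i j (by omega) z)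
  have hy_zero : y (m + 1) 0 rfl = u ⊗ₜ[k] q := rfl
  have hy_succ : ∀ i j hij, y i (j + 1) hij = (-1 : k) ^ i •
      LinearMap.lTensor (P i) (s j) (proj h hT Q i j (by omega) z) := fun _ _ _ => rfl
  have hsq : ∀ i : ℕ, (-1 : k) ^ i * (-1) ^ i = 1 := fun i => by
    rw [← mul_pow]; simp
  refine ⟨ofComponents h hT y, ext_proj h hT fun i j hij => ?_⟩
  rw [proj_d, proj_ofComponents, proj_ofComponents]
  cases j with
  | zero =>
    obtain rfl : i = m := hij
    rw [hy_zero, hy_succ i 0 rfl, LinearMap.rTensor_tmul, LinearMap.coe_restrictScalars, hu,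
      map_smul, smul_smul, hsq, one_smul]
    induction proj h hT Q i 0 rfl z with
    | zero => simp
    | add a b ha hb =>
      simp only [map_add, TensorProduct.add_tmul]
      rw [add_add_add_comm, ha, hb]
    | tmul a b =>
      simp only [LinearMap.lTensor_tmul, TensorProduct.rid_tmul, TensorProduct.smul_tmul,
        LinearMap.coe_restrictScalars, ← TensorProduct.tmul_add]
      rw [add_comm, hs_zero]
  | succ j =>
    rw [hy_succ (i + 1) j (by omega), hy_succ i (j + 1) (by omega)]
    have hsucc : (d'' (j + 1)).restrictScalars k ∘ₗ s (j + 1) =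
        LinearMap.id - s j ∘ₗ (d'' j).restrictScalars k :=
      LinearMap.ext fun x => eq_sub_of_add_eq (hs_succ j x)
    -- `1 ⊗ s` applied to the component of `d z = 0` in `P i ⊗ Q j` expresses `(1 ⊗ s d'') z`
    -- by `(d' ⊗ s) z`.
    have hc := congrArg (fun t => (-1 : k) ^ i • LinearMap.lTensor (P i) (s j) t)
      (hz i j (by omega) hij)
    simp only [map_add, map_smul, smul_add, smul_smul, hsq, one_smul, map_zero, smul_zero] at hc
    simp only [map_smul, smul_smul, hsq, one_smul]
    simp only [← LinearMap.comp_apply, ← LinearMap.lTensor_comp,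
      LinearMap.rTensor_comp_lTensor, LinearMap.lTensor_comp_rTensor, hsucc] at hc ⊢
    rw [LinearMap.lTensor_sub, LinearMap.lTensor_id, LinearMap.sub_apply, LinearMap.id_apply,
      pow_succ, mul_neg_one, neg_smul, eq_neg_of_add_eq_zero_left hc]
    abel

variable (μ : P 0 →ₗ[A] M) (ε : Q 0 →ₗ[k] k)

/-- `1 ⊗ ε` on the components `P m ⊗ Q 0`, and zero on the others, is a chain map from the twisted
product complex to `P`. -/
theorem rid_lTensor_d (hε : ∀ x, ε (d'' 0 x) = 0) {m : ℕ} (z : TwistedComplex h hT Q (m + 1)) :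
    TensorProduct.rid k (P m)
        (LinearMap.lTensor (P m) ε (proj h hT Q m 0 rfl (d h hT d' d'' m z))) =
      d' m (TensorProduct.rid k (P (m + 1))
        (LinearMap.lTensor (P (m + 1)) ε (proj h hT Q (m + 1) 0 rfl z))) := by
  have h1 : ε ∘ₗ (d'' 0).restrictScalars k = 0 := LinearMap.ext hε
  rw [proj_d h hT d' d'' (m := m) m 0 rfl, map_add, map_smul,
    ← LinearMap.comp_apply (LinearMap.lTensor (P m) ε) (LinearMap.lTensor (P m) _),
    ← LinearMap.lTensor_comp, h1, LinearMap.lTensor_zero,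
    LinearMap.zero_apply, smul_zero, add_zero]
  induction proj h hT Q (m + 1) 0 rfl z with
  | zero => simp
  | add a b ha hb => simp only [map_add, ha, hb]
  | tmul a b => simp [LinearMap.map_smul_of_tower]

/-- The twisted product of a resolution `P` of `M` and a resolution `Q` of `k` that is
contractible over `k` is exact. -/
theorem exact (hμ : Function.Exact (d' 0) μ) (hd' : ∀ i, Function.Exact (d' (i + 1)) (d' i))
    (hε : ∀ x, ε (d'' 0 x) = 0) (hd'' : ∀ j x, d'' j (d'' (j + 1) x) = 0)
    (q : Q 0) (s : ∀ j, Q j →ₗ[k] Q (j + 1))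
    (hs_zero : ∀ x, d'' 0 (s 0 x) + ε x • q = x)
    (hs_succ : ∀ j x, d'' (j + 1) (s (j + 1) x) + s j (d'' j x) = x) :
    Function.Exact (d h hT d' d'' 0)
        ((TensorProduct.rid k M).toLinearMap.toAddMonoidHom.comp (aug h hT μ ε)) ∧
      ∀ m, Function.Exact (d h hT d' d'' (m + 1)) (d h hT d' d'' m) := by
  refine ⟨fun z => ?_, fun m z => ⟨fun hz => ?_, ?_⟩⟩
  · have h1 : ((TensorProduct.rid k M).toLinearMap.toAddMonoidHom.comp (aug h hT μ ε)) z =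
        μ (TensorProduct.rid k (P 0) (LinearMap.lTensor (P 0) ε (proj h hT Q 0 0 rfl z))) :=
      rid_aug h hT μ ε z
    rw [h1]
    constructor
    · intro hz
      obtain ⟨u, hu⟩ := (hμ _).1 hz
      exact exists_d_eq h hT d' d'' ε q s hs_zero hs_succ z (fun i j hi _ => by omega) u hu
    · rintro ⟨y, rfl⟩
      rw [rid_lTensor_d h hT d' d'' ε hε]
      exact hμ.apply_apply_eq_zero _
  · have h1 := rid_lTensor_d h hT d' d'' ε hε z
    rw [hz, map_zero, map_zero, map_zero] at h1
    obtain ⟨u, hu⟩ := (hd' m _).1 h1.symm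
    refine exists_d_eq h hT d' d'' ε q s hs_zero hs_succ z (fun i j hi hj => ?_) u hu
    rw [← proj_d h hT d' d'' i j (by omega), hz, map_zero]
  · rintro ⟨y, rfl⟩
    exact d_d h hT d' d'' (fun i => (hd' i).apply_apply_eq_zero) hd'' m y

end TwistedComplex

end Exactness

end TruncOre

namespace TruncOre

/-! ### The standard resolution over `k[x]/(x^n)` -/

section StandardResolution

variable {k : Type*} [Field k] {n : ℕ}

theorem xbar_pow_self : xbar k n ^ n = 0 := by
  have := AdjoinRoot.eval₂_root (Polynomial.X ^ n : k[X])
  simpa using this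

variable (k n) in
/-- The basis `1, x̄, …, x̄^(n-1)` of `k[x]/(x^n)`. -/
noncomputable def powBasis : Module.Basis (Fin n) k (TruncPoly k n) :=
  (AdjoinRoot.powerBasisAux' (Polynomial.monic_X_pow (R := k) n)).reindex
    (finCongr (Polynomial.natDegree_X_pow n))

theorem powBasis_apply (l : Fin n) : powBasis k n l = xbar k n ^ (l : ℕ) := by
  rw [powBasis, Module.Basis.reindex_apply]
  exact (AdjoinRoot.powerBasis' (Polynomial.monic_X_pow (R := k) n)).basis_eq_pow
    ((finCongr (Polynomial.natDegree_X_pow n)).symm l)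

/-- Two `k`-linear maps on `k[x]/(x^n)` are equal if they agree on `x̄^l` for `l < n`. -/
theorem truncPoly_ext {V : Type*} [AddCommGroup V] [Module k V] {f g : TruncPoly k n →ₗ[k] V}
    (hfg : ∀ l < n, f (xbar k n ^ l) = g (xbar k n ^ l)) : f = g :=
  (powBasis k n).ext fun l => by rw [powBasis_apply]; exact hfg l l.2

variable (k n) in
/-- The `k`-linear contracting homotopy of the standard resolution. In even degrees it divides by
`x̄`, sending `1` to `0`; in odd degrees it divides by `x̄^(n-1)`, sending the lower powers of `x̄`
to `0`. -/
noncomputable def stdHomotopy (j : ℕ) : TruncPoly k n →ₗ[k] TruncPoly k n :=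
  (powBasis k n).constr k fun l =>
    if Even j then (if (l : ℕ) = 0 then 0 else xbar k n ^ ((l : ℕ) - 1))
    else if (l : ℕ) = n - 1 then 1 else 0

theorem stdHomotopy_pow (j : ℕ) {l : ℕ} (hl : l < n) :
    stdHomotopy k n j (xbar k n ^ l) =
      if Even j then (if l = 0 then 0 else xbar k n ^ (l - 1)) else if l = n - 1 then 1 else 0 := by
  have := (powBasis k n).constr_basis k (fun l : Fin n =>
    if Even j then (if (l : ℕ) = 0 then 0 else xbar k n ^ ((l : ℕ) - 1))
    else if (l : ℕ) = n - 1 then 1 else 0) ⟨l, hl⟩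
  rwa [powBasis_apply] at this

theorem augmentation_xbar (hn : 2 ≤ n) : augmentation (k := k) hn (xbar k n) = 0 := by
  simp [augmentation]

theorem augmentation_stdDiff (hn : 2 ≤ n) (b : TruncPoly k n) :
    augmentation (k := k) hn (stdDiff k n 0 b) = 0 := by
  simp [stdDiff, augmentation]

theorem stdDiff_stdDiff (hn : 2 ≤ n) (j : ℕ) (b : TruncPoly k n) :
    stdDiff k n j (stdDiff k n (j + 1) b) = 0 := by
  have h0 : xbar k n * xbar k n ^ (n - 1) = 0 := by
    rw [← pow_succ', Nat.sub_add_cancel (by omega), xbar_pow_self]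
  by_cases hj : Even j
  · simp only [stdDiff, hj, Nat.even_add_one, not_true, if_true, if_false,
      LinearMap.mulLeft_apply]
    rw [← mul_assoc, h0, zero_mul]
  · simp only [stdDiff, hj, Nat.even_add_one, not_false_iff, if_true, if_false,
      LinearMap.mulLeft_apply]
    rw [← mul_assoc, mul_comm _ (xbar k n), h0, zero_mul]

theorem stdHomotopy_zero (hn : 2 ≤ n) (b : TruncPoly k n) :
    stdDiff k n 0 (stdHomotopy k n 0 b) + (augmentation (k := k) hn).toLinearMap b • 1 = b := by
  have key : (stdDiff k n 0).restrictScalars k ∘ₗ stdHomotopy k n 0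
      + (augmentation (k := k) hn).toLinearMap.smulRight (1 : TruncPoly k n)
        = LinearMap.id := by
    refine truncPoly_ext fun l hl => ?_
    simp only [LinearMap.add_apply, LinearMap.comp_apply, stdHomotopy_pow 0 hl]
    rcases l with _ | l
    · simp
    · simp [stdDiff, augmentation_xbar, pow_succ']
  exact LinearMap.congr_fun key b

theorem stdHomotopy_succ (hn : 2 ≤ n) (j : ℕ) (b : TruncPoly k n) :
    stdDiff k n (j + 1) (stdHomotopy k n (j + 1) b) + stdHomotopy k n j (stdDiff k n j b) = b := by
  have key : (stdDiff k n (j + 1)).restrictScalars k ∘ₗ stdHomotopy k n (j + 1)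
      + stdHomotopy k n j ∘ₗ (stdDiff k n j).restrictScalars k = LinearMap.id := by
    refine truncPoly_ext fun l hl => ?_
    simp only [LinearMap.add_apply, LinearMap.comp_apply, LinearMap.coe_restrictScalars,
      LinearMap.id_apply, stdHomotopy_pow (j + 1) hl]
    by_cases hj : Even j
    · simp only [stdDiff, hj, Nat.even_add_one, not_true, if_true, if_false,
        LinearMap.mulLeft_apply, ← pow_succ']
      rcases eq_or_ne l (n - 1) with rfl | h1
      · rw [Nat.sub_add_cancel (by omega), xbar_pow_self]
        simp
      · rw [stdHomotopy_pow j (by omega)]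
        simp [hj, h1]
    · simp only [stdDiff, hj, Nat.even_add_one, not_false_iff, if_true, if_false,
        LinearMap.mulLeft_apply, ← pow_add]
      rcases l with _ | l
      · rw [add_zero, stdHomotopy_pow j (by omega)]
        simp [hj]
      · rw [show n - 1 + (l + 1) = n + l by omega, pow_add (xbar k n) n, xbar_pow_self]
        simp [pow_succ']
  exact LinearMap.congr_fun key b

end StandardResolution

/-! ### Linearity of the augmentation -/

section Augmentation

variable {k A B : Type*} [CommRing k] [Ring A] [Algebra k A] [Ring B] [Algebra k B]

theorem TwistedTensor.tmul_mul_one_tmul {τ : B ⊗[k] A →ₗ[k] A ⊗[k] B} (h : IsTwistingMap τ)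
    (a : A) (b b' : B) : tmul h a b * tmul h 1 b' = tmul h a (b * b') := by
  apply (equiv h).injective
  rw [equiv_mul, twistedMul_eq]
  simp [tmul, twistedAct_tmul, h.tmul_one]

theorem TwistedTensor.tmul_one_mul {τ : B ⊗[k] A →ₗ[k] A ⊗[k] B} (h : IsTwistingMap τ)
    (a : A) (b : B) : tmul h a b = tmul h a 1 * tmul h 1 b := by
  rw [tmul_mul_one_tmul, one_mul]

end Augmentation

section OreAugmentation

variable {k : Type*} [Field k] {n : ℕ}

/-- Evaluating the `B`-factor of `T_{s,t} (x̄^l ⊗ v)` at `x̄ = 0` leaves `t^l v`. -/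
theorem rid_augmentation_oreStep (hn : 2 ≤ n) {V : Type*} [AddCommGroup V] [Module k V]
    (s t : V →ₗ[k] V) (l : ℕ) (w : V ⊗[k] TruncPoly k n) :
    TensorProduct.rid k V (LinearMap.lTensor V (augmentation (k := k) hn).toLinearMap
        ((oreStep n s t ^ l) w)) =
      (t ^ l) (TensorProduct.rid k V
        (LinearMap.lTensor V (augmentation (k := k) hn).toLinearMap w)) := by
  have key : (TensorProduct.rid k V).toLinearMap
        ∘ₗ LinearMap.lTensor V (augmentation (k := k) hn).toLinearMap ∘ₗ oreStep n s t =
      t ∘ₗ (TensorProduct.rid k V).toLinearMap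
        ∘ₗ LinearMap.lTensor V (augmentation (k := k) hn).toLinearMap := by
    refine TensorProduct.ext' fun v b => ?_
    simp [oreStep, augmentation_xbar]
  induction l with
  | zero => rfl
  | succ l ih =>
    rw [pow_succ', pow_succ', Module.End.mul_apply, Module.End.mul_apply, ← ih]
    exact LinearMap.congr_fun key _

variable {A : Type*} [Ring A] [Algebra k A] {σ : A ≃ₐ[k] A} {δ : A →ₗ[k] A}
  (hA : IsTruncatedOre n σ δ)
  {M : Type*} [AddCommGroup M] [Module k M] [Module (OreExt hA) M]
  [IsScalarTower k (OreExt hA) M]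

theorem tmul_one_pow_smul (l : ℕ) (m : M) :
    TwistedTensor.tmul hA.twisting 1 (xbar k n ^ l) • m = (xAct hA M ^ l) m := by
  induction l with
  | zero => exact one_smul (OreExt hA) m
  | succ l ih =>
    rw [pow_succ', pow_succ', ← TwistedTensor.tmul_mul_one_tmul, mul_smul, ih]
    rfl

/-- The map `1 ⊗ ε : M ⊗ B → M ⊗ k = M` turns the twisted action, for which `x̄` acts by
`φ ⊗ x̄ + f ⊗ 1`, into the given action on `M`, for which `x̄` acts by `f`. -/
theorem rid_augmentation_twistedAct (hn : 2 ≤ n) [Module A M] [IsScalarTower k A M]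
    (hres : ∀ (a : A) (m : M), TwistedTensor.tmul hA.twisting a 1 • m = a • m)
    (φ : M →ₗ[k] M) (r : OreExt hA) (z : M ⊗[k] TruncPoly k n) :
    TensorProduct.rid k M (LinearMap.lTensor M (augmentation (k := k) hn).toLinearMap
        (twistedAct A (TruncPoly k n) (oreMap n φ (xAct hA M))
          (TwistedTensor.equiv hA.twisting r ⊗ₜ[k] z))) =
      r • TensorProduct.rid k M
        (LinearMap.lTensor M (augmentation (k := k) hn).toLinearMap z) := by
  induction z with
  | zero => simp
  | add u v hu hv => simp only [map_add, TensorProduct.tmul_add, smul_add, hu, hv]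
  | tmul m c =>
  obtain ⟨e, rfl⟩ := (TwistedTensor.equiv hA.twisting).symm.surjective r
  rw [LinearEquiv.apply_symm_apply]
  induction e with
  | zero => simp
  | add u v hu hv => simp only [map_add, TensorProduct.add_tmul, add_smul, hu, hv]
  | tmul a b =>
    have h1 : ∀ w : M ⊗[k] TruncPoly k n,
        TensorProduct.rid k M (LinearMap.lTensor M (augmentation (k := k) hn).toLinearMap
          (TensorProduct.map (Algebra.lsmul k k M a)
            ((Algebra.lsmul k k (TruncPoly k n)).toLinearMap.flip c) w)) =
        augmentation (k := k) hn c • a • TensorProduct.rid k M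
          (LinearMap.lTensor M (augmentation (k := k) hn).toLinearMap w) := by
      intro w
      induction w with
      | zero => simp
      | add u v hu hv => simp only [map_add, smul_add, hu, hv]
      | tmul u v =>
        simp only [TensorProduct.map_tmul, LinearMap.lTensor_tmul, TensorProduct.rid_tmul,
          LinearMap.flip_apply, AlgHom.toLinearMap_apply, Algebra.lsmul_coe, smul_eq_mul, map_mul]
        rw [mul_comm, mul_smul, smul_comm a]
    have h2 : TensorProduct.rid k M (LinearMap.lTensor M (augmentation (k := k) hn).toLinearMap
          (oreMap n φ (xAct hA M) (b ⊗ₜ[k] m))) =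
        TwistedTensor.tmul hA.twisting 1 b • m := by
      have key : (TensorProduct.rid k M).toLinearMap
            ∘ₗ LinearMap.lTensor M (augmentation (k := k) hn).toLinearMap
            ∘ₗ oreMap n φ (xAct hA M) ∘ₗ (TensorProduct.mk k (TruncPoly k n) M).flip m =
          (LinearMap.toSpanSingleton (OreExt hA) M m).restrictScalars k
            ∘ₗ (TwistedTensor.equiv hA.twisting).symm.toLinearMap
            ∘ₗ TensorProduct.mk k A (TruncPoly k n) 1 := by
        refine truncPoly_ext fun l hl => ?_
        have h3 := rid_augmentation_oreStep hn φ (xAct hA M) l (m ⊗ₜ[k] 1)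
        rw [← oreMap_pow φ (xAct hA M) hl] at h3
        refine h3.trans ?_
        rw [LinearMap.lTensor_tmul]
        simp only [AlgHom.toLinearMap_apply, map_one, TensorProduct.rid_tmul, one_smul]
        exact (tmul_one_pow_smul hA l m).symm
      exact LinearMap.congr_fun key b
    rw [twistedAct_tmul, h1, h2, ← hres, smul_smul (M := OreExt hA),
      ← TwistedTensor.tmul_one_mul]
    simp only [LinearMap.lTensor_tmul, TensorProduct.rid_tmul, AlgHom.toLinearMap_apply]
    exact (smul_comm _ _ m).symm

end OreAugmentation

end TruncOre
open TruncOre in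
theorem theorem3p10 {k : Type*} [Field k] {n : ℕ} (hn : 2 ≤ n)
    {A : Type*} [Ring A] [Algebra k A] {σ : A ≃ₐ[k] A} {δ : A →ₗ[k] A}
    (hA : IsTruncatedOre n σ δ)
    -- a left `A[x̄; σ, δ]`-module `M`, and its restriction to `A`
    {M : Type*} [AddCommGroup M] [Module k M] [Module (OreExt hA) M]
    [IsScalarTower k (OreExt hA) M] [Module A M] [IsScalarTower k A M]
    (hres : ∀ (a : A) (m : M), TwistedTensor.tmul hA.twisting a 1 • m = a • m)
    -- an isomorphism of `A`-modules from `M` to `M^σ`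
    (φ : M ≃ₗ[k] M) (hφ : ∀ (a : A) (m : M), φ (a • m) = σ a • φ m)
    (hM : IsCompatible (oreMap n σ.toLinearMap δ) (oreMap n φ.toLinearMap (xAct hA M)))
    -- a free resolution of `M` over `A`
    {P : ℕ → Type*} [∀ i, AddCommGroup (P i)] [∀ i, Module k (P i)] [∀ i, Module A (P i)]
    [∀ i, IsScalarTower k A (P i)]
    (d : ∀ i, P (i + 1) →ₗ[A] P i) (μ : P 0 →ₗ[A] M) (hP : IsFreeResolution d μ)
    -- an `A`-linear chain map from `P` to `P^σ`, the latter augmented by `φ⁻¹ μ`,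
    -- lifting the identity of `M`
    (σP : ∀ i, P i →ₗ[k] P i)
    (hσ_smul : ∀ (i : ℕ) (a : A) (z : P i), σP i (a • z) = σ a • σP i z)
    (hσ_chain : ∀ (i : ℕ) (z : P (i + 1)), d i (σP (i + 1) z) = σP i (d i z))
    (hσ_lift : ∀ z : P 0, φ.symm (μ (σP 0 z)) = μ z)
    -- a `k`-linear chain map lifting the action of `x̄` on `M`
    (δP : ∀ i, P i →ₗ[k] P i)
    (hδ_smul : ∀ (i : ℕ) (a : A) (z : P i), δP i (a • z) = σ a • δP i z + δ a • z)
    (hδ_chain : ∀ (i : ℕ) (z : P (i + 1)), d i (δP (i + 1) z) = δP i (d i z))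
    (hδ_lift : ∀ z : P 0, μ (δP 0 z) = xAct hA M (μ z))
    (hC : IsCompatibleResolution (oreMap n σ.toLinearMap δ) d μ
      (oreMap n φ.toLinearMap (xAct hA M)) (fun i => oreMap n (σP i) (δP i)))
    (hbij : ∀ i, Function.Bijective (σP i)) :
    -- the twisted product complex, augmented to `M ⊗ k = M` by `μ ⊗ ε`
    IsProjectiveResolution (OreExt hA)
      (TwistedComplex.d hA.twisting hC.compatible (Q := fun _ => TruncPoly k n) d (stdDiff k n))
      ((TensorProduct.rid k M).toLinearMap.toAddMonoidHom.comp
        (TwistedComplex.aug hA.twisting hC.compatible (Q := fun _ => TruncPoly k n) μ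
          (augmentation (k := k) hn).toLinearMap)) := by
  have hstd := TwistedComplex.exact hA.twisting hC.compatible (Q := fun _ => TruncPoly k n) d
    (stdDiff k n) μ (augmentation (k := k) hn).toLinearMap hP.exact_zero hP.exact_succ
    (augmentation_stdDiff hn) (stdDiff_stdDiff hn) 1 (stdHomotopy k n) (stdHomotopy_zero hn)
    (stdHomotopy_succ hn)
  have hlin := TwistedComplex.d_smul hA.twisting hC.compatible (Q := fun _ => TruncPoly k n) d
    (stdDiff k n) hC.chain
  refine ⟨hlin, fun r z => ?_, fun m => ?_, TwistedComplex.aug_surjective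
    hA.twisting hC.compatible (Q := fun _ => TruncPoly k n) μ _ hP.surjective 1
    (map_one (augmentation (k := k) hn)), hstd.1, hstd.2⟩
  · -- `μ ⊗ ε` factors as `(1 ⊗ ε) ∘ (μ ⊗ 1)` through the twisted module `M ⊗ B`.
    have hfac : ∀ z : TwistedComplex hA.twisting hC.compatible (fun _ => TruncPoly k n) 0,
        ((TensorProduct.rid k M).toLinearMap.toAddMonoidHom.comp
          (TwistedComplex.aug hA.twisting hC.compatible (Q := fun _ => TruncPoly k n) μ
            (augmentation (k := k) hn).toLinearMap)) z =
        TensorProduct.rid k M (LinearMap.lTensor M (augmentation (k := k) hn).toLinearMap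
          (LinearMap.rTensor (TruncPoly k n) (μ.restrictScalars k)
            (TwistedComplex.proj hA.twisting hC.compatible (fun _ => TruncPoly k n)
              0 0 rfl z))) := by
      intro z
      rw [← LinearMap.comp_apply (LinearMap.lTensor M _), LinearMap.lTensor_comp_rTensor]
      rfl
    refine (hfac _).trans (Eq.trans ?_ (congrArg (r • ·) (hfac z)).symm)
    rw [TwistedComplex.proj_smul, ← twistedAct_rTensor μ hC.lifts]
    exact rid_augmentation_twistedAct hA hn hres φ.toLinearMap r _
  · have : ∀ i, Module.Free A (P i) := hP.free
    have : ∀ p : {p : ℕ × ℕ // p.1 + p.2 = m}, Module.Free (OreExt hA)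
        (TwistedProd hA.twisting (hC.compatible p.1.1) (TruncPoly k n)) :=
      fun p => free_twistedProd hA.twisting (hC.compatible p.1.1)
    infer_instance
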